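/- Let $p$ be an odd prime, $F$ a non-archimedean local field of residue characteristic $p$, $E/F$ the unramified quadratic extension with ring of integers $\mathfrak o_E$, maximal ideal $\mathfrak p_E$, nontrivial Galois conjugation $x\mapsto\bar x$, and a uniformizer $\varpi_E$ of $E$ lying in $F$. Let $$G=U(2,1)(E/F)=\{g\in GL_3(E): h(gv,gw)=h(v,w)\ \text{for all } v,w\in E^3\},\qquad h(v,w)=v^{T}\beta\bar w,\quad \beta=\begin{pmatrix}0&0&1\\0&1&0\\1&0&0\end{pmatrix},$$ with the topology induced from $GL_3(E)$, and let $K$ be one of its two standard maximal compact open subgroups $$K_0=GL_3(\mathfrak o_E)\cap G,\qquad K_1=\begin{pmatrix}\mathfrak o_E&\mathfrak o_E&\mathfrak p_E^{-1}\\ \mathfrak p_E&\mathfrak o_E&\mathfrak o_E\\ \mathfrak p_E&\mathfrak p_E&\mathfrak o_E\end{pmatrix}\cap G.$$ Let $I_K\subseteq K$ be the Iwahori subgroup, i.e. the preimage in $K$ of the upper triangular subgroup of $K/K^1$, where $K^1$ is the maximal normal pro-$p$ subgroup of $K$; explicitly, $$I_{K_0}=\begin{pmatrix}\mathfrak o_E&\mathfrak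 o_E&\mathfrak o_E\\ \mathfrak p_E&\mathfrak o_E&\mathfrak o_E\\ \mathfrak p_E&\mathfrak p_E&\mathfrak o_E\end{pmatrix}\cap G,\qquad I_{K_1}=\begin{pmatrix}\mathfrak o_E&\mathfrak o_E&\mathfrak p_E^{-1}\\ \mathfrak p_E&\mathfrak o_E&\mathfrak o_E\\ \mathfrak p_E^2&\mathfrak p_E&\mathfrak o_E\end{pmatrix}\cap G.$$ Put $\alpha=\mathrm{diag}(\varpi_E^{-1},1,\varpi_E)\in G$. Let $(\sigma,W)$ be an irreducible smooth representation of $K$ over $\overline{\mathbf F}_p$, and let $\mathrm{ind}_K^G\sigma$ be the space of locally constant, compactly supported functions $f:G\to W$ with $f(kg)=\sigma(k)f(g)$ for $k\in K$, $g\in G$, on which $G$ acts by right translation. For $n\ge 0$ let $R_n^+(\sigma)$ (resp. $R_n^-(\sigma)$) be the subspace of functions supported in $K\alpha^nI_K$ (resp. $K\alpha^{-(n+1)}I_K$), and put $I^+(\sigma)=\bigoplus_{n\ge0}R_n^+(\sigma)$, $I^-(\sigma)=\bigoplus_{n\ge0}R_n^-(\sigma)$. Let $\pi$ be a smooth representation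 of $G$ over $\overline{\mathbf F}_p$ with a surjective $G$-map $\iota:\mathrm{ind}_K^G\sigma\to\pi$. Let $R(\sigma,\pi)=\ker\iota$, and let $I^{\pm}(\sigma,\pi)$ be the image of $I^{\pm}(\sigma)$ in $\pi$. If $R(\sigma,\pi)$ is finitely generated as an $\overline{\mathbf F}_p[G]$-module, then $I^+(\sigma,\pi)\cap I^-(\sigma,\pi)$ is a finite dimensional $\overline{\mathbf F}_p$-vector space. -/

import Mathlib

open scoped ValuativeRel

/-! ### Smooth representations and compact induction -/

section CompactInduction

variable {k G W : Type*} [Field k] [Group G] [TopologicalSpace G] [AddCommGroup W] [Module k W]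

/-- A representation of a topological group is smooth if the stabilizer of every vector is open. -/
def IsSmoothRep (ρ : Representation k G W) : Prop :=
  ∀ w : W, IsOpen {g : G | ρ g w = w}

/-- The space `S(G, σ)` of locally constant, compactly supported functions `f : G → W` such that
`f (κ g) = σ(κ) f(g)` for all `κ ∈ K` and `g ∈ G`. -/
def compactInd (K : Subgroup G) (σ : Representation k K W) : Submodule k (G → W) where
  carrier := {f | (∀ (κ : K) (g : G), f (κ * g) = σ κ (f g)) ∧ IsLocallyConstant f ∧
    HasCompactSupport f}
  zero_mem' := ⟨by simp, IsLocallyConstant.const 0, HasCompactSupport.zero⟩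
  add_mem' := by
    rintro f g ⟨h1, h2, h3⟩ ⟨h1', h2', h3'⟩
    exact ⟨fun κ x => by simp [h1, h1'], h2.add h2', h3.add h3'⟩
  smul_mem' := by
    rintro c f ⟨h1, h2, h3⟩
    exact ⟨fun κ x => by simp [h1], h2.comp (fun w => c • w),
      h3.comp_left (g := fun w => c • w) (smul_zero c)⟩

/-- The compactly induced representation `ind_K^G σ`: the group `G` acts on `S(G, σ)` by right
translation. -/
def compactIndRep [ContinuousMul G] (K : Subgroup G) (σ : Representation k K W) :
    Representation k G (compactInd K σ) where
  toFun x :=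
    { toFun := fun f => ⟨fun g => f.1 (g * x), fun κ g => by
          simpa [mul_assoc] using f.2.1 κ (g * x),
        f.2.2.1.comp_continuous (continuous_mul_const x),
        f.2.2.2.comp_homeomorph (Homeomorph.mulRight x)⟩
      map_add' := fun _ _ => rfl
      map_smul' := fun _ _ => rfl }
  map_one' := by ext f g; simp
  map_mul' x y := by ext f g; simp [mul_assoc]

/-- The functions in `ind_K^G σ` whose support is contained in `S`. -/
def compactIndSupportedOn (K : Subgroup G) (σ : Representation k K W) (S : Set G) :
    Submodule k (compactInd K σ) where
  carrier := {f | ∀ g, g ∉ S → f.1 g = 0}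
  zero_mem' := fun _ _ => rfl
  add_mem' := fun {f f'} hf hf' g hg => by simp [hf g hg, hf' g hg]
  smul_mem' := fun c f hf g hg => by simp [hf g hg]

end CompactInduction

/-! ### The unitary group `U(2, 1)(E/F)` and its subgroups -/

section LocalField

variable {L : Type*} [Field L] [ValuativeRel L]

/-- `x` is a uniformizer of the local field `L`. -/
def IsUniformizer (x : L) : Prop :=
  ∃ y : 𝒪[L], Irreducible y ∧ (y : L) = x

/-- The power `𝔭 ^ n`, `n ∈ ℤ`, of the maximal ideal of the local field `L`: the elements whose
absolute value is at most the `n`-th power of that of a uniformizer (all uniformizers have the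
same absolute value). -/
def primePow (L : Type*) [Field L] [ValuativeRel L] (n : ℤ) : Set L :=
  {x | ∀ ϖ : L, IsUniformizer ϖ →
    ValuativeRel.valuation L x ≤ ValuativeRel.valuation L ϖ ^ n}

lemma IsUniformizer.ne_zero {x : L} (h : IsUniformizer x) : x ≠ 0 := by
  obtain ⟨y, hy, rfl⟩ := h
  simpa using hy.ne_zero

lemma IsUniformizer.valuation_le_one {x : L} (h : IsUniformizer x) :
    ValuativeRel.valuation L x ≤ 1 := by
  obtain ⟨y, hy, rfl⟩ := h
  exact y.2

end LocalField

/-- An extension `E / F` of non-archimedean local fields is unramified if uniformizers of `F` are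
uniformizers of `E`, i.e. `𝔭_F 𝒪_E = 𝔭_E` (the extension of the residue fields is an extension of
finite fields, hence separable). -/
def IsUnramifiedExtension (F E : Type*) [Field F] [Field E] [Algebra F E] [ValuativeRel F]
    [ValuativeRel E] : Prop :=
  ∀ x : F, IsUniformizer x → IsUniformizer (algebraMap F E x)

section UnitaryGroup

variable {F E : Type*} [Field F] [Field E] [Algebra F E]

/-- The Hermitian form `h(v, w) = vᵀ β w̄` on `E³`, where `conj` is the conjugation `x ↦ x̄`. -/
def hermForm (conj : E ≃ₐ[F] E) (v w : Fin 3 → E) : E :=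
  v ⬝ᵥ ((!![0, 0, 1; 0, 1, 0; 1, 0, 0] : Matrix (Fin 3) (Fin 3) E).mulVec fun i => conj (w i))

/-- The unitary group `G = U(2, 1)(E/F)`: the elements of `GL(3, E)` preserving the form `h`. -/
def U21 (conj : E ≃ₐ[F] E) : Subgroup (GL (Fin 3) E) where
  carrier := {g | ∀ v w : Fin 3 → E,
    hermForm conj (g.1.mulVec v) (g.1.mulVec w) = hermForm conj v w}
  one_mem' := by simp
  mul_mem' := by
    intro a b ha hb v w
    simp only [Units.val_mul, ← Matrix.mulVec_mulVec]
    rw [ha, hb]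
  inv_mem' := by
    intro a ha v w
    rw [← ha, Matrix.mulVec_mulVec, Matrix.mulVec_mulVec, ← Units.val_mul]
    simp

/-- The diagonal element `α = diag(ϖ⁻¹, 1, ϖ)` of `G`, for `ϖ ∈ Fˣ`. -/
def alphaU21 (conj : E ≃ₐ[F] E) (ϖ : Fˣ) : U21 conj :=
  ⟨⟨Matrix.diagonal ![algebraMap F E ↑ϖ⁻¹, 1, algebraMap F E ϖ],
    Matrix.diagonal ![algebraMap F E ϖ, 1, algebraMap F E ↑ϖ⁻¹],
    by
      rw [Matrix.diagonal_mul_diagonal, ← Matrix.diagonal_one]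
      congr 1
      ext i
      fin_cases i <;> simp,
    by
      rw [Matrix.diagonal_mul_diagonal, ← Matrix.diagonal_one]
      congr 1
      ext i
      fin_cases i <;> simp⟩, by
    intro v w
    have h : algebraMap F E ϖ ≠ 0 := by simp
    simp [hermForm, dotProduct, Fin.sum_univ_three, Matrix.mulVec]
    field_simp⟩

variable [ValuativeRel E]

/-- For a matrix of integers `m` with `m i i = 0` and `m i j ≤ m i l + m l j`, the matrices over `E`
whose `(i, j)` entry lies in `𝔭_E ^ (m i j)` form an order; this is the group of the elements of `G`
that are units of that order. (For the symmetric `m` below, the condition on `g⁻¹` follows from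
the one on `g`, as `g⁻¹ = β ḡᵀ β`, so that the group is just the intersection of the order
with `G`.) -/
def patternSubgroup (conj : E ≃ₐ[F] E) (m : Matrix (Fin 3) (Fin 3) ℤ) (h0 : ∀ i, m i i = 0)
    (hm : ∀ i j l, m i j ≤ m i l + m l j) : Subgroup (U21 conj) where
  carrier := {g | ∀ i j, g.1.1 i j ∈ primePow E (m i j) ∧ g⁻¹.1.1 i j ∈ primePow E (m i j)}
  one_mem' := by
    have key : ∀ i j, (1 : Matrix (Fin 3) (Fin 3) E) i j ∈ primePow E (m i j) := by
      intro i j ϖ hϖ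
      by_cases hij : i = j
      · subst hij; simp [h0]
      · simp [Matrix.one_apply_ne hij]
    intro i j
    exact ⟨by simpa using key i j, by simpa using key i j⟩
  mul_mem' := by
    have key : ∀ A B : Matrix (Fin 3) (Fin 3) E, (∀ i j, A i j ∈ primePow E (m i j)) →
        (∀ i j, B i j ∈ primePow E (m i j)) → ∀ i j, (A * B) i j ∈ primePow E (m i j) := by
      intro A B hA hB i j ϖ hϖ
      have hne : ValuativeRel.valuation E ϖ ≠ 0 := by simpa using hϖ.ne_zero
      rw [Matrix.mul_apply]
      refine Valuation.map_sum_le _ fun l _ => ?_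
      rw [map_mul]
      refine (mul_le_mul' (hA i l ϖ hϖ) (hB l j ϖ hϖ)).trans ?_
      rw [← zpow_add₀ hne]
      exact zpow_le_zpow_right_of_le_one₀ (zero_lt_iff.mpr hne) hϖ.valuation_le_one (hm i j l)
    intro a b ha hb i j
    refine ⟨?_, ?_⟩
    · simpa using key a.1.1 b.1.1 (fun i j => (ha i j).1) (fun i j => (hb i j).1) i j
    · simpa using key b⁻¹.1.1 a⁻¹.1.1 (fun i j => (hb i j).2) (fun i j => (ha i j).2) i j
  inv_mem' := by
    intro a ha i j
    exact ⟨(ha i j).2, by simpa using (ha i j).1⟩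

/-- The maximal compact open subgroups of `G` (up to conjugacy): for `e = 0` the group `K₀` of the
elements with entries in `𝒪_E`, and for `e = 1` the group `K₁` of the elements whose `(1, 3)` entry
lies in `𝔭_E⁻¹`, whose `(2, 1)`, `(3, 1)` and `(3, 2)` entries lie in `𝔭_E`, and whose other entries
lie in `𝒪_E`. -/
def maxCompact (conj : E ≃ₐ[F] E) (e : Fin 2) : Subgroup (U21 conj) :=
  patternSubgroup conj
    (![!![0, 0, 0; 0, 0, 0; 0, 0, 0],
       !![0, 0, -1; 1, 0, 0; 1, 1, 0]] e)
    (by decide +revert) (by decide +revert)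

/-- The Iwahori subgroup `I_K` of `K = K₀` or `K = K₁`, i.e. the inverse image in `K` of the upper
triangular subgroup of `K / K¹`, where `K¹` is the maximal normal pro-`p` subgroup of `K`: the
elements of `K` such that, for `K₀`, the entries below the diagonal lie in `𝔭_E`, and for `K₁`, the
`(3, 1)` entry lies in `𝔭_E ^ 2`. -/
def iwahori (conj : E ≃ₐ[F] E) (e : Fin 2) : Subgroup (U21 conj) :=
  patternSubgroup conj
    (![!![0, 0, 0; 1, 0, 0; 1, 1, 0],
       !![0, 0, -1; 1, 0, 0; 2, 1, 0]] e)
    (by decide +revert) (by decide +revert)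

end UnitaryGroup

/-! ### The two halves of `ind_K^G σ` -/

section Halves

variable {F E : Type*} [Field F] [Field E] [Algebra F E] [ValuativeRel E] [TopologicalSpace E]
  {k W : Type*} [Field k] [AddCommGroup W] [Module k W]

/-- `R⁺_n(σ)`: the functions in `ind_K^G σ` supported in `K αⁿ I_K`. -/
def Rplus (conj : E ≃ₐ[F] E) (ϖ : Fˣ) (e : Fin 2) (σ : Representation k (maxCompact conj e) W)
    (n : ℕ) : Submodule k (compactInd (maxCompact conj e) σ) :=
  compactIndSupportedOn _ σ
    (DoubleCoset.doubleCoset (alphaU21 conj ϖ ^ n) (maxCompact conj e) (iwahori conj e))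

/-- `R⁻_n(σ)`: the functions in `ind_K^G σ` supported in `K α⁻⁽ⁿ⁺¹⁾ I_K`. -/
def Rminus (conj : E ≃ₐ[F] E) (ϖ : Fˣ) (e : Fin 2) (σ : Representation k (maxCompact conj e) W)
    (n : ℕ) : Submodule k (compactInd (maxCompact conj e) σ) :=
  compactIndSupportedOn _ σ
    (DoubleCoset.doubleCoset (alphaU21 conj ϖ ^ (-((n : ℤ) + 1))) (maxCompact conj e)
      (iwahori conj e))

/-- `I⁺(σ)`, the sum of the `R⁺_n(σ)`, `n ≥ 0`. -/
def Iplus (conj : E ≃ₐ[F] E) (ϖ : Fˣ) (e : Fin 2) (σ : Representation k (maxCompact conj e) W) :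
    Submodule k (compactInd (maxCompact conj e) σ) :=
  ⨆ n : ℕ, Rplus conj ϖ e σ n

/-- `I⁻(σ)`, the sum of the `R⁻_{n-1}(σ)`, `n ≥ 1`. -/
def Iminus (conj : E ≃ₐ[F] E) (ϖ : Fˣ) (e : Fin 2) (σ : Representation k (maxCompact conj e) W) :
    Submodule k (compactInd (maxCompact conj e) σ) :=
  ⨆ n : ℕ, Rminus conj ϖ e σ n

end Halves

/-!
The group `G` acts on a tree, `K` is the stabilizer of a vertex and `I_K` the stabilizer of an edge
at this vertex. Removing the edge cuts the tree into two halves, and `I⁺(σ)`, `I⁻(σ)` consist of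
functions living on the one or the other half. If `ι f = ι f'` with `f ∈ I⁺(σ)` and `f' ∈ I⁻(σ)`,
then `r = f - f'` lies in the kernel `R(σ, π)` of `ι`, and `f` is the restriction of `r` to the
first half. The kernel is spanned by the translates of finitely many functions. A translate whose support
lies in one half restricts either to itself, which `ι` kills, or to zero. So the intersection of the
two images is spanned by the images of the restrictions of the translates that straddle the edge;
the translating elements of these form a relatively compact set, so only finitely many functions
occur (`finiteDimensional_map_inf_map_of_ker_fg`).

The tree is replaced by norms of columns of matrices. Let `e₁, e₂, e₃` be the standard basis of
`E³`. The group `K` preserves the norm of the lattice `𝒪 ⊕ 𝒪 ⊕ t𝒪` with `t = 1` for `K₀` and `t = ϖ`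
for `K₁`, and the first half is given by the condition `|t| ‖g e₃‖ ≤ ‖g e₁‖` (`plusHalf`); this
holds on `K αⁿ I_K` for `n ≥ 0` and fails on `K α⁻ⁿ I_K` for `n > 0`. It is not needed that
these double cosets exhaust `G`.

The geometric input is that left multiplication by a bounded element `γ` moves only a bounded set of
elements `g` out of the first half (`mem_boundedSet_of_mul_notMem_plusHalf`). Here `x = g e₁` and
`y = g e₃` are isotropic vectors with `h(x, y) = 1`, which forces `y` to be a multiple `a x` with
`|t a| ≤ 1` up to a bounded vector (`exists_eq_smul_add_of_isotropic`); hence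
`|t| ‖γ y‖ ≤ ‖γ x‖` as soon as `x` is long. All of this uses that the conjugation preserves the
absolute value of `E`, which follows from Hensel's lemma since `p` is odd (`valuation_conj`).
-/

/-! ### Finitely generated subrepresentations -/

/-- A finitely generated subrepresentation is spanned, as a vector space, by the translates of
finitely many vectors. -/
lemma exists_finite_generators_of_fg {k G U : Type*} [Field k] [Group G] [AddCommGroup U]
    [Module k U] {ρ : Representation k G U} {R : Subrepresentation ρ} (h : R.asSubmodule.FG) :
    ∃ S : Set U, S.Finite ∧ (∀ r ∈ S, r ∈ R) ∧
      ∀ N : Submodule k U, (∀ r ∈ S, ∀ g, ρ g r ∈ N) → ∀ r ∈ R, r ∈ N := by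
  obtain ⟨S, hS⟩ := h
  refine ⟨(S : Set ρ.asModule), S.finite_toSet, fun r hr => ?_, fun N hN r hr => ?_⟩
  · rw [← Subrepresentation.mem_asSubmodule_iff, ← hS]
    exact Submodule.subset_span hr
  · -- The largest subrepresentation contained in `N`.
    let N' : Subrepresentation ρ :=
      { toSubmodule := ⨅ g, N.comap (ρ g)
        apply_mem_toSubmodule := fun g v hv => by
          simp only [Submodule.mem_iInf, Submodule.mem_comap] at hv ⊢
          intro g'
          rw [← Module.End.mul_apply, ← map_mul]
          exact hv _ }
    have hle : R.asSubmodule ≤ N'.asSubmodule := by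
      rw [← hS, Submodule.span_le]
      exact fun (r : U) hr => (Submodule.mem_iInf (fun g => N.comap (ρ g))).2 fun g => hN r hr g
    have h1 : r ∈ ⨅ g, N.comap (ρ g) := hle hr
    simpa using (Submodule.mem_iInf _).1 h1 1

/-! ### Compact induction -/

section CompactInduction

variable {k G W : Type*} [Field k] [Group G] [TopologicalSpace G] [AddCommGroup W] [Module k W]

/-- Restriction of the functions in `ind_K^G σ` to a clopen set which is stable under left
multiplication by `K`, extended by zero. -/
noncomputable def compactIndRestrict (K : Subgroup G) (σ : Representation k K W) (A : Set G)
    (hA : IsClopen A) (hKA : ∀ (κ : K) (g : G), (κ : G) * g ∈ A ↔ g ∈ A) :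
    compactInd K σ →ₗ[k] compactInd K σ where
  toFun f := ⟨A.indicator f.1, by
    classical
    refine ⟨fun κ g => ?_, ?_, ?_⟩
    · by_cases h : g ∈ A
      · rw [Set.indicator_of_mem h, Set.indicator_of_mem ((hKA κ g).2 h), f.2.1]
      · rw [Set.indicator_of_notMem h, Set.indicator_of_notMem (mt (hKA κ g).1 h), map_zero]
    · rw [IsLocallyConstant.iff_exists_open]
      intro g
      obtain ⟨U, hU, hgU, h⟩ := (IsLocallyConstant.iff_exists_open _).1 f.2.2.1 g
      by_cases hg : g ∈ A
      · exact ⟨U ∩ A, hU.inter hA.2, ⟨hgU, hg⟩, fun x hx => by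
          rw [Set.indicator_of_mem hg, Set.indicator_of_mem hx.2, h x hx.1]⟩
      · exact ⟨Aᶜ, hA.compl.2, hg, fun x hx => by
          rw [Set.indicator_of_notMem hg, Set.indicator_of_notMem hx]⟩
    · exact f.2.2.2.mono fun g hg => by
        simp only [Function.mem_support] at hg ⊢
        intro h0
        exact hg (by simp [Set.indicator_apply, h0])⟩
  map_add' f f' := Subtype.ext (Set.indicator_add' A f.1 f'.1)
  map_smul' c f := by
    ext g
    by_cases h : g ∈ A <;> simp [h]

variable {K : Subgroup G} {σ : Representation k K W}

lemma compactIndRestrict_eq_self {A : Set G} (hA : IsClopen A)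
    (hKA : ∀ (κ : K) (g : G), (κ : G) * g ∈ A ↔ g ∈ A) {f : compactInd K σ}
    (hf : ∀ g, f.1 g ≠ 0 → g ∈ A) : compactIndRestrict K σ A hA hKA f = f := by
  ext g
  by_cases h : g ∈ A
  · simp [compactIndRestrict, h]
  · have : f.1 g = 0 := not_not.1 fun h0 => h (hf g h0)
    simp [compactIndRestrict, h, this]

lemma compactIndRestrict_eq_zero {A : Set G} (hA : IsClopen A)
    (hKA : ∀ (κ : K) (g : G), (κ : G) * g ∈ A ↔ g ∈ A) {f : compactInd K σ}
    (hf : ∀ g, f.1 g ≠ 0 → g ∉ A) : compactIndRestrict K σ A hA hKA f = 0 := by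
  ext g
  by_cases h : g ∈ A
  · have : f.1 g = 0 := not_not.1 fun h0 => hf g h0 h
    simp [compactIndRestrict, h, this]
  · simp [compactIndRestrict, h]

variable [IsTopologicalGroup G]

/-- Every function in `ind_K^G σ` is invariant under right translation by some neighbourhood
of `1`. -/
lemma exists_nhds_compactIndRep_apply_eq (f : compactInd K σ) :
    ∃ V ∈ nhds (1 : G), ∀ x ∈ V, compactIndRep K σ x f = f := by
  have hopen : IsOpen {q : G × G | f.1 (q.1 * q.2) = f.1 q.1} :=
    ((f.2.2.1.comp_continuous continuous_mul).prodMk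
      (f.2.2.1.comp_continuous continuous_fst)) {w : W × W | w.1 = w.2}
  obtain ⟨U, V, -, hV, hU, hV1, hUV⟩ := generalized_tube_lemma f.2.2.2.isCompact
    (isCompact_singleton (x := (1 : G))) hopen (by rintro ⟨a, b⟩ ⟨-, rfl⟩; simp)
  have key : ∀ g, f.1 g ≠ 0 → ∀ x ∈ V, f.1 (g * x) = f.1 g := fun g hg x hx =>
    hUV (Set.mk_mem_prod (hU (subset_tsupport _ hg)) hx)
  have hV' : V ∈ nhds (1 : G) := hV.mem_nhds (hV1 rfl)
  refine ⟨V ∩ V⁻¹, Filter.inter_mem hV' (inv_mem_nhds_one G hV'), fun x hx => ?_⟩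
  ext g
  change f.1 (g * x) = f.1 g
  by_cases hg : f.1 g = 0
  · -- If `f (g * x) ≠ 0`, invariance under `x⁻¹ ∈ V` at the point `g * x` gives `f g ≠ 0`.
    by_contra hne
    rw [hg] at hne
    have := key (g * x) hne x⁻¹ hx.2
    rw [mul_inv_cancel_right, hg] at this
    exact hne this.symm
  · exact key g hg x hx.1

/-- The translates of a function in `ind_K^G σ` by the elements of a compact set are finite in
number. -/
lemma finite_compactIndRep_image (f : compactInd K σ) {B : Set G} (hB : IsCompact B) :
    ((fun g => compactIndRep K σ g f) '' B).Finite := by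
  obtain ⟨V, hV, h⟩ := exists_nhds_compactIndRep_apply_eq f
  let _ : TopologicalSpace (compactInd K σ) := ⊥
  have _ : DiscreteTopology (compactInd K σ) := ⟨rfl⟩
  have hcont : Continuous fun g => compactIndRep K σ g f := by
    refine (IsLocallyConstant.iff_eventually_eq _).2 (fun g => ?_) |>.continuous
    have hg : Filter.Tendsto (fun y => g⁻¹ * y) (nhds g) (nhds 1) := by
      simpa using (continuous_const_mul g⁻¹).tendsto g
    filter_upwards [hg hV] with y hy
    calc compactIndRep K σ y f = compactIndRep K σ (g * (g⁻¹ * y)) f := by simp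
      _ = compactIndRep K σ g f := by rw [map_mul, Module.End.mul_apply, h _ hy]
  exact (hB.image hcont).finite DiscreteTopology.isDiscrete

/-- Let `G = A ⊔ Aᶜ` be a decomposition into clopen left `K`-invariant pieces such that the
translates `C * g⁻¹` of a compact set `C` lie on one side, for all `g` outside some compact set.
If the kernel of an equivariant map on `ind_K^G σ` is finitely generated, then the images of the
functions supported in `A` and of those supported in `Aᶜ` have a finite dimensional
intersection. -/
theorem finiteDimensional_map_inf_map_of_ker_fg {V : Type*} [AddCommGroup V] [Module k V]
    {π : Representation k G V} (ι : (compactIndRep K σ).IntertwiningMap π)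
    (hfg : ι.ker.asSubmodule.FG) {A : Set G} (hA : IsClopen A)
    (hKA : ∀ (κ : K) (g : G), (κ : G) * g ∈ A ↔ g ∈ A)
    (hsep : ∀ C : Set G, IsCompact C → ∃ B : Set G, IsCompact B ∧ ∀ g ∉ B,
      (∀ x, x * g ∈ C → x ∈ A) ∨ (∀ x, x * g ∈ C → x ∉ A))
    {P M : Submodule k (compactInd K σ)} (hP : ∀ f ∈ P, ∀ g, f.1 g ≠ 0 → g ∈ A)
    (hM : ∀ f ∈ M, ∀ g, f.1 g ≠ 0 → g ∉ A) :
    FiniteDimensional k ↥(P.map ι.toLinearMap ⊓ M.map ι.toLinearMap) := by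
  obtain ⟨S, hS, hSker, hSgen⟩ := exists_finite_generators_of_fg hfg
  choose B hBc hB using fun r : compactInd K σ => hsep _ r.2.2.2.isCompact
  -- The image of the part of a function supported in `A`; on the kernel of `ι` it takes values in
  -- the span of the finite set `T`, coming from the translates that straddle `A` and `Aᶜ`.
  let cut := ι.toLinearMap ∘ₗ compactIndRestrict K σ A hA hKA
  have hcut : ∀ f, cut f = ι (compactIndRestrict K σ A hA hKA f) := fun _ => rfl
  let T : Set V := ⋃ r ∈ S, cut '' ((fun g => compactIndRep K σ g r) '' B r)
  have hT : T.Finite := hS.biUnion fun r _ => (finite_compactIndRep_image r (hBc r)).image _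
  have hgen : ∀ r ∈ S, ∀ g, cut (compactIndRep K σ g r) ∈ Submodule.span k T := by
    intro r hr g
    have hker : ι r = 0 := hSker r hr
    by_cases hg : g ∈ B r
    · exact Submodule.subset_span (Set.mem_biUnion hr ⟨_, ⟨g, hg, rfl⟩, rfl⟩)
    · have hsupp : ∀ x, (compactIndRep K σ g r).1 x ≠ 0 → x * g ∈ tsupport r.1 :=
        fun x hx => subset_tsupport _ hx
      have h0 : cut (compactIndRep K σ g r) = 0 := by
        rcases hB r g hg with h | h
        · rw [hcut, compactIndRestrict_eq_self hA hKA fun x hx => h x (hsupp x hx),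
            ι.isIntertwining, hker, map_zero]
        · rw [hcut, compactIndRestrict_eq_zero hA hKA fun x hx => h x (hsupp x hx), map_zero]
      rw [h0]
      exact Submodule.zero_mem _
  have : FiniteDimensional k (Submodule.span k T) := FiniteDimensional.span_of_finite k hT
  refine Submodule.finiteDimensional_of_le (S₂ := Submodule.span k T) ?_
  rintro _ ⟨⟨f, hf, rfl⟩, ⟨f', hf', h⟩⟩
  have h1 : f - f' ∈ ι.ker := by
    change ι (f - f') = 0
    rw [map_sub]
    exact sub_eq_zero.2 h.symm
  have h2 : cut (f - f') ∈ Submodule.span k T :=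
    hSgen ((Submodule.span k T).comap cut) hgen _ h1
  rwa [map_sub, hcut, hcut, compactIndRestrict_eq_self hA hKA (hP f hf),
    compactIndRestrict_eq_zero hA hKA (hM f' hf'), map_zero, sub_zero] at h2

end CompactInduction

/-! ### The conjugation is an isometry -/

section Conjugation

variable {F E : Type*} [Field F] [Field E] [Algebra F E]

lemma conj_conj (hdeg : Module.finrank F E = 2) (conj : E ≃ₐ[F] E) (hconj : conj ≠ AlgEquiv.refl)
    (x : E) : conj (conj x) = x := by
  have _ : FiniteDimensional F E := Module.finite_of_finrank_eq_succ hdeg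
  have hcard : Fintype.card (E ≃ₐ[F] E) = 2 :=
    le_antisymm (hdeg ▸ AlgEquiv.card_le) (Fintype.one_lt_card_iff.2 ⟨conj, 1, hconj⟩)
  have h : conj ^ 2 = 1 := hcard ▸ pow_card_eq_one
  simpa [pow_two] using DFunLike.congr_fun h x

open ValuativeRel Polynomial

section Uniformizer

variable [ValuativeRel E]

lemma IsUniformizer.valuation_lt_one {ϖ : E} (hϖ : IsUniformizer ϖ) : valuation E ϖ < 1 := by
  obtain ⟨y, hy, rfl⟩ := hϖ
  exact Valuation.integer.v_irreducible_lt_one hy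

lemma IsUniformizer.valuation_pos {ϖ : E} (hϖ : IsUniformizer ϖ) : 0 < valuation E ϖ := by
  simpa [zero_lt_iff] using hϖ.ne_zero

variable [TopologicalSpace E] [IsNonarchimedeanLocalField E]

lemma IsUniformizer.le_of_lt_one {ϖ : E} (hϖ : IsUniformizer ϖ) {x : E}
    (hx : valuation E x < 1) : valuation E x ≤ valuation E ϖ := by
  obtain ⟨y, hy, rfl⟩ := hϖ
  have hmem : (⟨x, hx.le⟩ : 𝒪[E]) ∈ 𝓂[E] := by
    rw [IsLocalRing.mem_maximalIdeal, mem_nonunits_iff,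
      Valuation.Integer.not_isUnit_iff_valuation_lt_one]
    exact hx
  rw [(IsDiscreteValuationRing.irreducible_iff_uniformizer y).1 hy,
    Ideal.mem_span_singleton] at hmem
  exact (Valuation.integer.integers (valuation E)).le_of_dvd hmem

lemma IsUniformizer.valuation_eq {ϖ ϖ' : E} (hϖ : IsUniformizer ϖ) (hϖ' : IsUniformizer ϖ') :
    valuation E ϖ = valuation E ϖ' :=
  le_antisymm (hϖ'.le_of_lt_one hϖ.valuation_lt_one) (hϖ.le_of_lt_one hϖ'.valuation_lt_one)

lemma IsUniformizer.valuation_ne_sq {ϖ : E} (hϖ : IsUniformizer ϖ) (y : E) :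
    valuation E ϖ ≠ valuation E y ^ 2 := by
  intro h
  have h1 : valuation E y < 1 := by
    by_contra! hy
    exact (hϖ.valuation_lt_one.trans_le (one_le_pow₀ hy)).ne h
  have h2 : valuation E ϖ ≤ valuation E ϖ * valuation E ϖ := by
    conv_lhs => rw [h, pow_two]
    exact mul_le_mul' (hϖ.le_of_lt_one h1) (hϖ.le_of_lt_one h1)
  exact h2.not_gt (mul_lt_of_lt_one_left hϖ.valuation_pos hϖ.valuation_lt_one)

end Uniformizer

/-- Hensel's lemma for square roots: in a local field of odd residue characteristic the principal
units are squares. -/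
lemma exists_sq_eq_one_add [ValuativeRel E] [TopologicalSpace E] [IsNonarchimedeanLocalField E]
    (h2 : valuation E 2 = 1) {x : E} (hx : valuation E x < 1) : ∃ s : E, s ^ 2 = 1 + x := by
  let _ := IsTopologicalAddGroup.rightUniformSpace E
  have _ := isUniformAddGroup_of_addCommGroup (G := E)
  have hH : HenselianRing 𝒪[E] 𝓂[E] := IsAdicComplete.henselianRing 𝒪[E] 𝓂[E]
  let y : 𝒪[E] := ⟨x, hx.le⟩
  have hy : y ∈ 𝓂[E] := by
    rw [IsLocalRing.mem_maximalIdeal, mem_nonunits_iff,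
      Valuation.Integer.not_isUnit_iff_valuation_lt_one]
    exact hx
  have h2' : IsUnit (2 : 𝒪[E]) :=
    (Valuation.integer.integers (valuation E)).isUnit_of_one' h2
  obtain ⟨a, ha, -⟩ := hH.is_henselian (X ^ 2 - C (1 + y)) (monic_X_pow_sub_C _ two_ne_zero) 1
    (by simpa using hy) (by simpa [one_add_one_eq_two] using h2'.map (Ideal.Quotient.mk 𝓂[E]))
  refine ⟨a, ?_⟩
  have : a ^ 2 = 1 + y := by simpa [sub_eq_zero] using ha
  exact congrArg (Subtype.val : 𝒪[E] → E) this

/-- The valuation of `2` is trivial if the residue characteristic is odd. -/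
lemma valuation_two_eq_one {p : ℕ} [Fact p.Prime] (hp : p ≠ 2) [ValuativeRel F] [CharP 𝓀[F] p]
    [ValuativeRel E] [ValuativeExtension F E] : valuation E 2 = 1 := by
  have h2 : (2 : 𝓀[F]) ≠ 0 := by
    intro h
    have h' := (CharP.cast_eq_zero_iff 𝓀[F] p 2).1 (by exact_mod_cast h)
    exact hp ((Nat.prime_dvd_prime_iff_eq Fact.out Nat.prime_two).1 h')
  have hF : IsUnit (2 : 𝒪[F]) := by
    by_contra hn
    refine h2 ?_
    have := (IsLocalRing.residue_eq_zero_iff (2 : 𝒪[F])).2 hn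
    rwa [map_ofNat] at this
  have hF1 : valuation F 2 = 1 := (Valuation.integer.integers (valuation F)).one_of_isUnit hF
  have key : ∀ a b : F, valuation F a ≤ valuation F b →
      valuation E (algebraMap F E a) ≤ valuation E (algebraMap F E b) := fun a b h => by
    rw [← Valuation.Compatible.vle_iff_le] at h ⊢
    exact (ValuativeExtension.vle_iff_vle a b).2 h
  have h1 := key 2 1 (by simp [hF1])
  have h1' := key 1 2 (by simp [hF1])
  simp only [map_ofNat, map_one] at h1 h1'
  exact le_antisymm h1 h1'

/-- The ring of integers of `E` consists of the `x` such that `1 + ϖ * x ^ 2` is a square, for a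
uniformizer `ϖ` and odd residue characteristic: if `x` is not integral, then `ϖ * x ^ 2` has
absolute value greater than `1` and odd valuation. -/
lemma valuation_le_one_iff_isSquare [ValuativeRel E] [TopologicalSpace E]
    [IsNonarchimedeanLocalField E] (h2 : valuation E 2 = 1) {ϖ : E} (hϖ : IsUniformizer ϖ) (x : E) :
    valuation E x ≤ 1 ↔ ∃ s : E, s ^ 2 = 1 + ϖ * x ^ 2 := by
  constructor
  · intro hx
    refine exists_sq_eq_one_add h2 ?_
    rw [map_mul, map_pow]
    exact (mul_le_of_le_one_right' (pow_le_one' hx 2)).trans_lt hϖ.valuation_lt_one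
  · rintro ⟨s, hs⟩
    by_contra! hx
    have hx0 : 0 < valuation E x := zero_lt_one.trans hx
    have h1 : 1 ≤ valuation E ϖ * valuation E x := by
      have := hϖ.le_of_lt_one (x := x⁻¹) (by rw [map_inv₀]; exact inv_lt_one_of_one_lt₀ hx)
      rw [map_inv₀] at this
      exact (inv_le_iff_one_le_mul₀ hx0).1 this
    have h3 : 1 < valuation E (ϖ * x ^ 2) := by
      rw [map_mul, map_pow, pow_two, ← mul_assoc]
      exact hx.trans_le (le_mul_of_one_le_left' h1)
    have h4 := congrArg (valuation E) hs
    rw [Valuation.map_add_eq_of_lt_right _ (by rwa [map_one]), map_mul, map_pow, map_pow] at h4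
    refine hϖ.valuation_ne_sq (s / x) ?_
    rw [map_div₀, div_pow, h4, mul_div_cancel_right₀ _ (pow_ne_zero 2 hx0.ne')]

/-- The nontrivial automorphism of a quadratic extension of local fields preserves the absolute
value: it preserves the ring of integers by `valuation_le_one_iff_isSquare`. -/
lemma valuation_conj [ValuativeRel E] [TopologicalSpace E]
    [IsNonarchimedeanLocalField E] (h2 : valuation E 2 = 1) {ϖ : F}
    (hϖ : IsUniformizer (algebraMap F E ϖ)) (conj : E ≃ₐ[F] E) (hcc : ∀ x, conj (conj x) = x)
    (x : E) : valuation E (conj x) = valuation E x := by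
  have hle : ∀ x, valuation E x ≤ 1 → valuation E (conj x) ≤ 1 := by
    intro x hx
    obtain ⟨s, hs⟩ := (valuation_le_one_iff_isSquare h2 hϖ x).1 hx
    exact (valuation_le_one_iff_isSquare h2 hϖ _).2 ⟨conj s, by simpa using congrArg conj hs⟩
  -- If `|x| ≤ |x̄|`, apply this to `x / x̄`.
  have key : ∀ x, valuation E x ≤ valuation E (conj x) → valuation E (conj x) ≤ valuation E x := by
    intro x hx
    rcases eq_or_ne x 0 with rfl | h0
    · simp
    have h := hle (x / conj x) (by
      rw [map_div₀]
      exact div_le_one_of_le₀ hx zero_le)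
    rw [map_div₀, hcc, map_div₀] at h
    exact (div_le_one₀ (by simpa [zero_lt_iff] using h0)).1 h
  rcases le_total (valuation E x) (valuation E (conj x)) with h | h
  · exact le_antisymm (key x h) h
  · exact le_antisymm h (by simpa [hcc] using key (conj x) (by simpa [hcc] using h))

end Conjugation

/-! ### Lattice norms -/

section LatticeNorm

open ValuativeRel

variable {E : Type*} [Field E] [ValuativeRel E]

/-- The norm on `E³` whose unit ball is the lattice `𝒪 ⊕ 𝒪 ⊕ t𝒪`, where `τ` is the absolute value
of `t`. The maximal compact subgroup `K₀` or `K₁` preserves it for `τ = 1` or `τ = |ϖ|`. -/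
noncomputable def latticeNorm (τ : ValueGroupWithZero E) (x : Fin 3 → E) : ValueGroupWithZero E :=
  max (max (valuation E (x 0)) (valuation E (x 1))) (valuation E (x 2) / τ)

variable {τ : ValueGroupWithZero E} {x y : Fin 3 → E}

lemma latticeNorm_le_iff (hτ : 0 < τ) {c : ValueGroupWithZero E} :
    latticeNorm τ x ≤ c ↔
      valuation E (x 0) ≤ c ∧ valuation E (x 1) ≤ c ∧ valuation E (x 2) ≤ c * τ := by
  simp [latticeNorm, and_assoc, div_le_iff₀ hτ]

lemma valuation_le_latticeNorm (hτ : 0 < τ) (hτ1 : τ ≤ 1) (x : Fin 3 → E) (i : Fin 3) :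
    valuation E (x i) ≤ latticeNorm τ x := by
  obtain ⟨h0, h1, h2⟩ := (latticeNorm_le_iff hτ (x := x)).1 le_rfl
  fin_cases i
  · exact h0
  · exact h1
  · exact h2.trans (mul_le_of_le_one_right' hτ1)

lemma latticeNorm_le_of_forall_le (hτ : 0 < τ) (hτ1 : τ ≤ 1) {c : ValueGroupWithZero E}
    (h : ∀ i, valuation E (x i) ≤ c) : latticeNorm τ x ≤ c * τ⁻¹ := by
  have hc : c ≤ c * τ⁻¹ := le_mul_of_one_le_right' ((one_le_inv₀ hτ).2 hτ1)
  rw [latticeNorm_le_iff hτ, inv_mul_cancel_right₀ hτ.ne']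
  exact ⟨(h 0).trans hc, (h 1).trans hc, h 2⟩

lemma latticeNorm_add_le (hτ : 0 < τ) (x y : Fin 3 → E) :
    latticeNorm τ (x + y) ≤ max (latticeNorm τ x) (latticeNorm τ y) := by
  obtain ⟨h0, h1, h2⟩ := (latticeNorm_le_iff hτ (x := x)).1 (le_max_left _ (latticeNorm τ y))
  obtain ⟨h0', h1', h2'⟩ := (latticeNorm_le_iff hτ (x := y)).1 (le_max_right (latticeNorm τ x) _)
  exact (latticeNorm_le_iff hτ).2 ⟨Valuation.map_add_le _ h0 h0', Valuation.map_add_le _ h1 h1',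
    Valuation.map_add_le _ h2 h2'⟩

lemma latticeNorm_smul_le (hτ : 0 < τ) (a : E) (x : Fin 3 → E) :
    latticeNorm τ (a • x) ≤ valuation E a * latticeNorm τ x := by
  obtain ⟨h0, h1, h2⟩ := (latticeNorm_le_iff hτ (x := x)).1 le_rfl
  refine (latticeNorm_le_iff hτ).2 ⟨?_, ?_, ?_⟩ <;>
    simp only [Pi.smul_apply, smul_eq_mul, map_mul, mul_assoc]
  · exact mul_le_mul_right h0 _
  · exact mul_le_mul_right h1 _
  · exact mul_le_mul_right h2 _

lemma valuation_mulVec_le {A : Matrix (Fin 3) (Fin 3) E} {B c : ValueGroupWithZero E}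
    (hA : ∀ i j, valuation E (A i j) ≤ B) (hx : ∀ i, valuation E (x i) ≤ c) (i : Fin 3) :
    valuation E (A.mulVec x i) ≤ B * c := by
  change valuation E (∑ j, A i j * x j) ≤ _
  refine (valuation E).map_sum_le fun j _ => ?_
  rw [map_mul]
  exact mul_le_mul' (hA i j) (hx j)

/-- A matrix that maps the lattice `𝒪 ⊕ 𝒪 ⊕ t𝒪` to itself does not increase its norm. -/
lemma latticeNorm_mulVec_le (hτ : 0 < τ) {A : Matrix (Fin 3) (Fin 3) E}
    (hA : ∀ i j, valuation E (A i j) * ![1, 1, τ] j ≤ ![1, 1, τ] i) (x : Fin 3 → E) :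
    latticeNorm τ (A.mulVec x) ≤ latticeNorm τ x := by
  obtain ⟨h0, h1, h2⟩ := (latticeNorm_le_iff hτ (x := x)).1 le_rfl
  have hx : ∀ j, valuation E (x j) ≤ ![1, 1, τ] j * latticeNorm τ x := by
    intro j
    fin_cases j
    · simpa using h0
    · simpa using h1
    · simpa [mul_comm] using h2
  have key : ∀ i, valuation E (A.mulVec x i) ≤ ![1, 1, τ] i * latticeNorm τ x := by
    intro i
    change valuation E (∑ j, A i j * x j) ≤ _
    refine (valuation E).map_sum_le fun j _ => ?_
    rw [map_mul]
    calc _ ≤ valuation E (A i j) * (![1, 1, τ] j * latticeNorm τ x) := mul_le_mul_right (hx j) _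
      _ ≤ _ := by rw [← mul_assoc]; exact mul_le_mul_left (hA i j) _
  exact (latticeNorm_le_iff hτ).2 ⟨by simpa using key 0, by simpa using key 1,
    by simpa [mul_comm] using key 2⟩

end LatticeNorm

/-! ### Pairs of isotropic vectors -/

section Isotropic

open ValuativeRel

variable {F E : Type*} [Field F] [Field E] [Algebra F E]

lemma hermForm_apply (conj : E ≃ₐ[F] E) (x y : Fin 3 → E) :
    hermForm conj x y = x 0 * conj (y 2) + x 1 * conj (y 1) + x 2 * conj (y 0) := by
  simp [hermForm, dotProduct, Matrix.mulVec, Fin.sum_univ_three]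

lemma hermForm_sub_smul (conj : E ≃ₐ[F] E) (a : E) (x y z : Fin 3 → E) :
    hermForm conj (y - a • x) z = hermForm conj y z - a * hermForm conj x z := by
  simp only [hermForm_apply, Pi.sub_apply, Pi.smul_apply, smul_eq_mul]
  ring

lemma hermForm_conj_symm (conj : E ≃ₐ[F] E) (hcc : ∀ x, conj (conj x) = x) (x y : Fin 3 → E) :
    hermForm conj y x = conj (hermForm conj x y) := by
  simp only [hermForm_apply, map_add, map_mul, hcc]
  ring

variable [ValuativeRel E]

/-- An isotropic vector has a dominant first or last coordinate. -/
lemma dominant_of_isotropic (conj : E ≃ₐ[F] E)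
    (hv : ∀ x, valuation E (conj x) = valuation E x) {τ : ValueGroupWithZero E} (hτ : 0 < τ)
    (hτ1 : τ ≤ 1) {x : Fin 3 → E} (hxx : hermForm conj x x = 0) :
    latticeNorm τ x ≤ valuation E (x 0) ∨ latticeNorm τ x * τ ≤ valuation E (x 2) := by
  by_contra! h
  obtain ⟨h0, h2⟩ := h
  have h2' : valuation E (x 2) < latticeNorm τ x := h2.trans_le (mul_le_of_le_one_right' hτ1)
  have hprod : valuation E (x 0) * valuation E (x 2) < latticeNorm τ x ^ 2 := by
    rw [pow_two]
    exact mul_lt_mul'' h0 h2' zero_le zero_le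
  have h1 : valuation E (x 1) ^ 2 ≤ valuation E (x 0) * valuation E (x 2) := by
    have : x 1 * conj (x 1) = -(x 0 * conj (x 2) + x 2 * conj (x 0)) := by
      rw [hermForm_apply] at hxx
      linear_combination hxx
    have h := congrArg (valuation E) this
    rw [map_mul, hv, Valuation.map_neg, ← pow_two] at h
    rw [h]
    exact Valuation.map_add_le _ (by rw [map_mul, hv]) (by rw [map_mul, hv, mul_comm])
  have h1' : valuation E (x 1) < latticeNorm τ x :=
    lt_of_pow_lt_pow_left₀ 2 zero_le (h1.trans_lt hprod)
  refine lt_irrefl (latticeNorm τ x) ?_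
  conv_lhs => rw [latticeNorm]
  exact max_lt (max_lt h0 h1') ((div_lt_iff₀ hτ).2 h2)

/-- Let `x, y` be isotropic vectors with `h(x, y) = 1`. If `y` is at most as long as `x`, up to the
factor `τ`, and `x` is not short, then `y` is a small multiple of `x` up to a bounded vector:
choose the multiple so that a dominant first or last coordinate of `x` is cleared. -/
lemma exists_eq_smul_add_of_isotropic (conj : E ≃ₐ[F] E) (hcc : ∀ x, conj (conj x) = x)
    (hv : ∀ x, valuation E (conj x) = valuation E x) {τ : ValueGroupWithZero E} (hτ : 0 < τ)
    (hτ1 : τ ≤ 1) {x y : Fin 3 → E} (hxx : hermForm conj x x = 0) (hyy : hermForm conj y y = 0)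
    (hxy : hermForm conj x y = 1) (hle : τ * latticeNorm τ y ≤ latticeNorm τ x)
    (hx : 1 ≤ latticeNorm τ x) :
    ∃ (a : E) (z : Fin 3 → E), y = a • x + z ∧ τ * valuation E a ≤ 1 ∧
      ∀ i, valuation E (z i) ≤ τ⁻¹ * τ⁻¹ := by
  have hτ' : 1 ≤ τ⁻¹ := (one_le_inv₀ hτ).2 hτ1
  have hN : 0 < latticeNorm τ x := zero_lt_one.trans_le hx
  have hyx : hermForm conj y x = 1 := by rw [hermForm_conj_symm conj hcc, hxy, map_one]
  have hzz : ∀ a : E, hermForm conj (y - a • x) (y - a • x) = -(a + conj a) := by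
    intro a
    rw [hermForm_sub_smul, hermForm_conj_symm conj hcc _ y, hermForm_conj_symm conj hcc _ x,
      hermForm_sub_smul, hermForm_sub_smul, hxx, hyy, hxy, hyx]
    simp only [mul_one, mul_zero, sub_zero, zero_sub, map_neg, map_one]
    ring
  have hzx : ∀ a : E, hermForm conj (y - a • x) x = 1 := by
    intro a
    rw [hermForm_sub_smul, hyx, hxx, mul_zero, sub_zero]
  -- The middle coordinate is controlled by `h(z, z)`.
  have hmid : ∀ a : E, τ * valuation E a ≤ 1 →
      (y - a • x) 1 * conj ((y - a • x) 1) = -(a + conj a) →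
      valuation E ((y - a • x) 1) ≤ τ⁻¹ := by
    intro a ha h
    have h' := congrArg (valuation E) h
    rw [map_mul, hv, Valuation.map_neg, ← pow_two] at h'
    have h1 : valuation E (a + conj a) ≤ τ⁻¹ := by
      have : valuation E a ≤ τ⁻¹ := (le_inv_mul_iff₀ hτ).2 ha |>.trans_eq (mul_one _)
      exact Valuation.map_add_le _ this (by rwa [hv])
    rw [← h'] at h1
    exact le_of_pow_le_pow_left₀ two_ne_zero zero_le
      (h1.trans (by rw [pow_two]; exact le_mul_of_one_le_left' hτ'))
  -- The remaining coordinate `s` is controlled by `h(z, x) = 1`.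
  have hlast : ∀ s d t : E, s * conj d + t * conj (x 1) = 1 →
      latticeNorm τ x * τ ≤ valuation E d → valuation E t ≤ τ⁻¹ → valuation E s ≤ τ⁻¹ * τ⁻¹ := by
    intro s d t h hd ht
    have h1 : valuation E (s * conj d) ≤ τ⁻¹ * latticeNorm τ x := by
      rw [eq_sub_of_add_eq h]
      refine (valuation E).map_sub_le ?_ ?_
      · rw [map_one]
        exact hx.trans (le_mul_of_one_le_left' hτ')
      · rw [map_mul, hv]
        exact mul_le_mul' ht (valuation_le_latticeNorm hτ hτ1 x 1)
    rw [map_mul, hv] at h1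
    have h2 : valuation E s * (latticeNorm τ x * τ) ≤ τ⁻¹ * latticeNorm τ x :=
      (mul_le_mul_right hd _).trans h1
    rw [← le_div_iff₀ (mul_pos hN hτ)] at h2
    refine h2.trans_eq ?_
    field_simp
  have hsmall : ∀ i, latticeNorm τ x * τ ≤ valuation E (x i) →
      τ * valuation E (y i) ≤ valuation E (x i) → x i ≠ 0 ∧ τ * valuation E (y i / x i) ≤ 1 := by
    intro i h h'
    have h0 : 0 < valuation E (x i) := (mul_pos hN hτ).trans_le h
    refine ⟨fun h1 => h0.ne' (by simp [h1]), ?_⟩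
    rw [map_div₀, ← mul_div_assoc]
    exact (div_le_one₀ h0).2 h'
  rcases dominant_of_isotropic conj hv hτ hτ1 hxx with hd | hd
  · have hd' := (mul_le_of_le_one_right' hτ1).trans hd
    obtain ⟨hx0, ha⟩ := hsmall 0 hd' (((mul_le_mul_right
      (valuation_le_latticeNorm hτ hτ1 y 0) τ).trans hle).trans hd)
    have hz0 : (y - (y 0 / x 0) • x) 0 = 0 := by simp [hx0]
    have h1 := hzz (y 0 / x 0)
    have h2 := hzx (y 0 / x 0)
    rw [hermForm_apply, hz0] at h1 h2
    have hz1 := hmid _ ha (by simpa using h1)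
    refine ⟨y 0 / x 0, y - (y 0 / x 0) • x, by simp, ha, fun i => ?_⟩
    fin_cases i
    · exact (congrArg (valuation E) hz0).trans_le (by simp)
    · exact hz1.trans (le_mul_of_one_le_left' hτ')
    · exact hlast ((y - (y 0 / x 0) • x) 2) (x 0) _ (by linear_combination h2) hd' hz1
  · have hy2 : valuation E (y 2) ≤ latticeNorm τ y * τ :=
      ((latticeNorm_le_iff hτ).1 le_rfl).2.2
    obtain ⟨hx0, ha⟩ := hsmall 2 hd (by
      refine ((mul_le_mul_right hy2 τ).trans ?_).trans hd
      rw [← mul_assoc]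
      exact mul_le_mul_left hle τ)
    have hz0 : (y - (y 2 / x 2) • x) 2 = 0 := by simp [hx0]
    have h1 := hzz (y 2 / x 2)
    have h2 := hzx (y 2 / x 2)
    rw [hermForm_apply, hz0] at h1 h2
    have hz1 := hmid _ ha (by simpa using h1)
    refine ⟨y 2 / x 2, y - (y 2 / x 2) • x, by simp, ha, fun i => ?_⟩
    fin_cases i
    · exact hlast ((y - (y 2 / x 2) • x) 0) (x 2) _ (by linear_combination h2) hd hz1
    · exact hz1.trans (le_mul_of_one_le_left' hτ')
    · exact (congrArg (valuation E) hz0).trans_le (by simp)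

end Isotropic

/-! ### Bounded subsets of the unitary group -/

section Bounded

open ValuativeRel

variable {F E : Type*} [Field F] [Field E] [Algebra F E]

section Entries

variable {conj : E ≃ₐ[F] E} [TopologicalSpace E]

lemma continuous_entry (i j : Fin 3) : Continuous fun g : U21 conj => g.1.1 i j :=
  (Units.continuous_val.comp continuous_subtype_val).matrix_elem i j

lemma continuous_inv_entry [IsTopologicalRing E] (i j : Fin 3) :
    Continuous fun g : U21 conj => g⁻¹.1.1 i j :=
  (continuous_entry i j).comp continuous_inv

end Entries

variable [ValuativeRel E]

/-- The elements of the unitary group such that the entries of the matrix and of its inverse have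
absolute value at most `B`. -/
def boundedSet (conj : E ≃ₐ[F] E) (B : ValueGroupWithZero E) : Set (U21 conj) :=
  {g | ∀ i j, valuation E (g.1.1 i j) ≤ B ∧ valuation E (g⁻¹.1.1 i j) ≤ B}

variable {conj : E ≃ₐ[F] E} {B B' : ValueGroupWithZero E}

lemma inv_mem_boundedSet {g : U21 conj} (h : g ∈ boundedSet conj B) : g⁻¹ ∈ boundedSet conj B :=
  fun i j => ⟨(h i j).2, by simpa using (h i j).1⟩

lemma boundedSet_mono (h : B ≤ B') : boundedSet conj B ⊆ boundedSet conj B' :=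
  fun _ hg i j => ⟨(hg i j).1.trans h, (hg i j).2.trans h⟩

lemma mul_mem_boundedSet {g g' : U21 conj} (h : g ∈ boundedSet conj B)
    (h' : g' ∈ boundedSet conj B') : g * g' ∈ boundedSet conj (B * B') := by
  intro i j
  constructor
  · change valuation E (∑ l, g.1.1 i l * g'.1.1 l j) ≤ _
    refine (valuation E).map_sum_le fun l _ => ?_
    rw [map_mul]
    exact mul_le_mul' (h i l).1 (h' l j).1
  · rw [mul_inv_rev, mul_comm B]
    change valuation E (∑ l, g'⁻¹.1.1 i l * g⁻¹.1.1 l j) ≤ _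
    refine (valuation E).map_sum_le fun l _ => ?_
    rw [map_mul]
    exact mul_le_mul' (h' i l).2 (h l j).2

variable [TopologicalSpace E] [IsNonarchimedeanLocalField E]

lemma isOpen_valuation_le {γ : ValueGroupWithZero E} (hγ : γ ≠ 0) :
    IsOpen {x : E | valuation E x ≤ γ} := by
  rw [isOpen_iff_mem_nhds]
  intro x hx
  refine Filter.mem_of_superset ((IsValuativeTopology.hasBasis_nhds' x).mem_of_mem hγ) ?_
  intro z hz
  have := Valuation.map_add_le (valuation E) (le_of_lt hz) hx
  simpa using this

variable (E) in
lemma t2Space_of_isNonarchimedeanLocalField : T2Space E :=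
  IsTopologicalAddGroup.t2Space_of_zero_sep fun x hx =>
    ⟨_, (IsValuativeTopology.hasBasis_nhds_zero' E).mem_of_mem
      (i := valuation E x) (by simpa using hx), fun h => lt_irrefl (valuation E x) h⟩

lemma isOpen_boundedSet (hB : B ≠ 0) : IsOpen (boundedSet conj B) := by
  simp only [boundedSet, Set.ofPred_forall, Set.ofPred_and]
  exact isOpen_iInter_of_finite fun i => isOpen_iInter_of_finite fun j =>
    ((isOpen_valuation_le hB).preimage (continuous_entry i j)).inter
      ((isOpen_valuation_le hB).preimage (continuous_inv_entry i j))

lemma exists_subset_boundedSet {C : Set (U21 conj)} (hC : IsCompact C) :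
    ∃ B, 1 ≤ B ∧ C ⊆ boundedSet conj B := by
  have hcover : C ⊆ ⋃ B : {B : ValueGroupWithZero E // 1 ≤ B}, boundedSet conj B.1 := by
    intro g _
    let b := Finset.univ.sup fun q : Fin 3 × Fin 3 =>
      max (valuation E (g.1.1 q.1 q.2)) (valuation E (g⁻¹.1.1 q.1 q.2))
    have hb : ∀ i j, max (valuation E (g.1.1 i j)) (valuation E (g⁻¹.1.1 i j)) ≤ b := fun i j =>
      Finset.le_sup (f := fun q : Fin 3 × Fin 3 =>
        max (valuation E (g.1.1 q.1 q.2)) (valuation E (g⁻¹.1.1 q.1 q.2))) (Finset.mem_univ (i, j))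
    exact Set.mem_iUnion.2 ⟨⟨max 1 b, le_max_left _ _⟩, fun i j =>
      ⟨(le_max_left _ _).trans ((hb i j).trans (le_max_right _ _)),
        (le_max_right _ _).trans ((hb i j).trans (le_max_right _ _))⟩⟩
  have hdir : Directed (· ⊆ ·)
      fun B : {B : ValueGroupWithZero E // 1 ≤ B} => boundedSet conj B.1 := by
    intro B B'
    exact ⟨⟨max B.1 B'.1, B.2.trans (le_max_left _ _)⟩, boundedSet_mono (le_max_left _ _),
      boundedSet_mono (le_max_right _ _)⟩
  have _ : Nonempty {B : ValueGroupWithZero E // 1 ≤ B} := ⟨⟨1, le_rfl⟩⟩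
  obtain ⟨B, hB⟩ := hC.elim_directed_cover _
    (fun B => isOpen_boundedSet (zero_lt_one.trans_le B.2).ne') hcover hdir
  exact ⟨B.1, B.2, hB⟩

lemma continuous_conj (hv : ∀ x, valuation E (conj x) = valuation E x) : Continuous conj := by
  refine continuous_of_continuousAt_zero conj.toRingEquiv.toRingHom.toAddMonoidHom ?_
  have h := IsValuativeTopology.hasBasis_nhds_zero' E
  change Filter.Tendsto conj (nhds 0) (nhds (conj 0))
  rw [map_zero]
  refine (h.tendsto_iff h).2 fun γ hγ => ⟨γ, hγ, fun x hx => ?_⟩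
  change valuation E (conj x) < γ
  rwa [hv]

lemma isClosed_U21 (hv : ∀ x, valuation E (conj x) = valuation E x) :
    IsClosed (U21 conj : Set (GL (Fin 3) E)) := by
  have hc := continuous_conj hv
  have _ : T2Space E := t2Space_of_isNonarchimedeanLocalField E
  change IsClosed {g : GL (Fin 3) E | ∀ v w : Fin 3 → E,
    hermForm conj (g.1.mulVec v) (g.1.mulVec w) = hermForm conj v w}
  simp only [Set.ofPred_forall]
  refine isClosed_iInter fun v => isClosed_iInter fun w => isClosed_eq ?_ continuous_const
  have h : ∀ (u : Fin 3 → E) i, Continuous fun g : GL (Fin 3) E => g.1.mulVec u i := fun u i =>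
    (continuous_apply i).comp (Units.continuous_val.matrix_mulVec continuous_const)
  simp only [hermForm_apply]
  exact (((h v 0).mul (hc.comp (h w 2))).add ((h v 1).mul (hc.comp (h w 1)))).add
    ((h v 2).mul (hc.comp (h w 0)))

lemma isCompact_boundedSet (hv : ∀ x, valuation E (conj x) = valuation E x)
    (B : ValueGroupWithZero E) : IsCompact (boundedSet conj B) := by
  have _ : T2Space E := t2Space_of_isNonarchimedeanLocalField E
  let S : Set (Matrix (Fin 3) (Fin 3) E) := {A | ∀ i j, valuation E (A i j) ≤ B}
  have hS : IsCompact S := by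
    have := isCompact_univ_pi fun _ : Fin 3 => isCompact_univ_pi fun _ : Fin 3 =>
      IsNonarchimedeanLocalField.isCompact_closedBall E B
    convert! this using 1
    exact Set.ext fun A => ⟨fun h i _ j _ => h i j, fun h i j => h i trivial j trivial⟩
  have hemb : Topology.IsClosedEmbedding
      (Units.embedProduct (Matrix (Fin 3) (Fin 3) E)) := by
    refine ⟨Units.isEmbedding_embedProduct, ?_⟩
    have : Set.range (Units.embedProduct (Matrix (Fin 3) (Fin 3) E)) =
        {q | q.1 * q.2.unop = 1 ∧ q.2.unop * q.1 = 1} := by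
      ext q
      constructor
      · rintro ⟨u, rfl⟩
        simp
      · rintro ⟨h1, h2⟩
        exact ⟨⟨q.1, q.2.unop, h1, h2⟩, rfl⟩
    rw [this]
    exact (isClosed_eq (by fun_prop) continuous_const).inter
      (isClosed_eq (by fun_prop) continuous_const)
  have hS' : IsCompact (MulOpposite.unop ⁻¹' S) :=
    MulOpposite.opHomeomorph.symm.isCompact_preimage.2 hS
  have hK := (hemb.comp (isClosed_U21 hv).isClosedEmbedding_subtypeVal).isCompact_preimage
    (hS.prod hS')
  convert! hK using 1
  exact Set.ext fun g => ⟨fun h => ⟨fun i j => (h i j).1, fun i j => (h i j).2⟩,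
    fun h i j => ⟨h.1 i j, h.2 i j⟩⟩

end Bounded

/-! ### The two halves of the group -/

section Halves

open ValuativeRel

variable {F E : Type*} [Field F] [Field E] [Algebra F E] {conj : E ≃ₐ[F] E}

lemma hermForm_col (g : U21 conj) (i j : Fin 3) :
    hermForm conj (fun l => g.1.1 l i) (fun l => g.1.1 l j) = if j = i.rev then 1 else 0 := by
  have h := g.2 (Pi.single i 1) (Pi.single j 1)
  rw [Matrix.mulVec_single_one, Matrix.mulVec_single_one] at h
  refine h.trans ?_
  rw [hermForm_apply]
  fin_cases i <;> fin_cases j <;> simp [Fin.ext_iff]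

/-- The inverse of a unitary matrix is its conjugate transpose with respect to `h`. -/
lemma inv_entry (g : U21 conj) (i j : Fin 3) : g⁻¹.1.1 i j = conj (g.1.1 j.rev i.rev) := by
  have h := g.2 (g⁻¹.1.1.mulVec (Pi.single j 1)) (Pi.single i.rev 1)
  have h1 : g.1.1.mulVec (g⁻¹.1.1.mulVec (Pi.single j 1)) = Pi.single j 1 := by
    rw [Matrix.mulVec_mulVec, ← Units.val_mul, ← Subgroup.coe_mul, mul_inv_cancel]
    exact Matrix.one_mulVec _
  rw [h1, Matrix.mulVec_single_one, Matrix.mulVec_single_one, hermForm_apply, hermForm_apply] at h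
  fin_cases i <;> fin_cases j <;> simpa [Pi.single_apply, Fin.ext_iff, Fin.rev] using h.symm

/-- The antidiagonal entries of `g * g⁻¹ = 1`. -/
lemma row_relation (g : U21 conj) (i : Fin 3) :
    g.1.1 i 0 * conj (g.1.1 i 2) + g.1.1 i 1 * conj (g.1.1 i 1) + g.1.1 i 2 * conj (g.1.1 i 0) =
      if i = 1 then 1 else 0 := by
  have h : (g * g⁻¹).1.1 i i.rev = if i = 1 then 1 else 0 := by
    rw [mul_inv_cancel]
    fin_cases i <;> simp
  rw [← h]
  change _ = ∑ l, g.1.1 i l * g⁻¹.1.1 l i.rev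
  rw [Fin.sum_univ_three, inv_entry, inv_entry, inv_entry, Fin.rev_rev]
  rfl

variable [ValuativeRel E]

/-- The elements of the unitary group whose last column is at most as long as the first one, with
respect to the rescaled basis of the lattice `𝒪 ⊕ 𝒪 ⊕ t𝒪`. The double cosets `K αⁿ I_K`, `n ≥ 0`,
are contained in this set, and the `K α⁻ⁿ I_K`, `n > 0`, in its complement. -/
def plusHalf (conj : E ≃ₐ[F] E) (τ : ValueGroupWithZero E) : Set (U21 conj) :=
  {g | τ * latticeNorm τ (fun i => g.1.1 i 2) ≤ latticeNorm τ (fun i => g.1.1 i 0)}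

variable {τ : ValueGroupWithZero E}

/-- A unitary matrix is bounded if its outer columns are: the middle column is controlled by the
relations between the entries of a row. -/
lemma mem_boundedSet_of_col (hv : ∀ x, valuation E (conj x) = valuation E x) {g : U21 conj}
    {D : ValueGroupWithZero E} (hD : 1 ≤ D) (h0 : ∀ i, valuation E (g.1.1 i 0) ≤ D)
    (h2 : ∀ i, valuation E (g.1.1 i 2) ≤ D) : g ∈ boundedSet conj D := by
  have h1 : ∀ i, valuation E (g.1.1 i 1) ≤ D := by
    intro i
    refine le_of_pow_le_pow_left₀ two_ne_zero zero_le ?_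
    have h := row_relation g i
    have h' : g.1.1 i 1 * conj (g.1.1 i 1) = (if i = 1 then 1 else 0) -
        (g.1.1 i 0 * conj (g.1.1 i 2) + g.1.1 i 2 * conj (g.1.1 i 0)) := by
      rw [← h]
      ring
    have h'' := congrArg (valuation E) h'
    rw [map_mul, hv, ← pow_two] at h''
    rw [h'', pow_two]
    refine (valuation E).map_sub_le ?_ ((valuation E).map_add_le ?_ ?_)
    · split_ifs
      · rw [map_one]
        exact one_le_mul hD hD
      · simp
    · rw [map_mul, hv]
      exact mul_le_mul' (h0 i) (h2 i)
    · rw [map_mul, hv]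
      exact mul_le_mul' (h2 i) (h0 i)
  have hall : ∀ i j, valuation E (g.1.1 i j) ≤ D := by
    intro i j
    fin_cases j
    · exact h0 i
    · exact h1 i
    · exact h2 i
  exact fun i j => ⟨hall i j, by rw [inv_entry, hv]; exact hall _ _⟩

/-- Left multiplication by a bounded element moves only a bounded set out of `plusHalf`. -/
lemma mem_boundedSet_of_mul_notMem_plusHalf (hcc : ∀ x, conj (conj x) = x)
    (hv : ∀ x, valuation E (conj x) = valuation E x) (hτ : 0 < τ) (hτ1 : τ ≤ 1)
    {B : ValueGroupWithZero E} (hB : 1 ≤ B) {γ g : U21 conj} (hγ : γ ∈ boundedSet conj B)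
    (hg : g ∈ plusHalf conj τ) (hγg : γ * g ∉ plusHalf conj τ) :
    g ∈ boundedSet conj (B * B * τ⁻¹ ^ 4) := by
  have hτ' : 1 ≤ τ⁻¹ := (one_le_inv₀ hτ).2 hτ1
  set x : Fin 3 → E := fun i => g.1.1 i 0
  set y : Fin 3 → E := fun i => g.1.1 i 2
  have hle : τ * latticeNorm τ y ≤ latticeNorm τ x := hg
  have hmul : ∀ j, (fun i => (γ * g).1.1 i j) = γ.1.1.mulVec (fun i => g.1.1 i j) := fun _ => rfl
  have hBB : 1 ≤ B * B := one_le_mul hB hB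
  have hlt : latticeNorm τ (γ.1.1.mulVec x) < τ * latticeNorm τ (γ.1.1.mulVec y) := by
    have h := hγg
    simp only [plusHalf, Set.mem_ofPred_eq, hmul, not_le] at h
    exact h
  have hx : latticeNorm τ x ≤ B * B * τ⁻¹ ^ 3 := by
    -- Write `y = a • x + z`; if `γ x` were longer than the bound for `γ z`, then `γ y` would be
    -- too short for `γ * g` to leave `plusHalf`.
    rcases lt_or_ge (latticeNorm τ x) 1 with h1 | h1
    · exact h1.le.trans (one_le_mul hBB (one_le_pow₀ hτ'))
    obtain ⟨a, z, hyz, ha, hz⟩ := exists_eq_smul_add_of_isotropic conj hcc hv hτ hτ1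
      (by simpa using hermForm_col g 0 0) (by simpa using hermForm_col g 2 2)
      (by simpa using hermForm_col g 0 2) hle h1
    have hγz : τ * latticeNorm τ (γ.1.1.mulVec z) ≤ B * (τ⁻¹ * τ⁻¹) := by
      have := latticeNorm_le_of_forall_le hτ hτ1 (valuation_mulVec_le (fun i j => (hγ i j).1) hz)
      refine (mul_le_mul_right this τ).trans_eq ?_
      field_simp
    have hγx : latticeNorm τ (γ.1.1.mulVec x) ≤ B * (τ⁻¹ * τ⁻¹) := by
      by_contra! hcon
      refine hlt.not_ge ?_
      rw [hyz, Matrix.mulVec_add, Matrix.mulVec_smul]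
      refine (mul_le_mul_right (latticeNorm_add_le hτ _ _) τ).trans ?_
      rw [mul_max]
      refine max_le ?_ (hγz.trans hcon.le)
      refine (mul_le_mul_right (latticeNorm_smul_le hτ _ _) τ).trans ?_
      rw [← mul_assoc]
      exact mul_le_of_le_one_left' ha
    have hxγ : x = γ⁻¹.1.1.mulVec (γ.1.1.mulVec x) := by
      rw [Matrix.mulVec_mulVec]
      simp
    rw [hxγ]
    refine (latticeNorm_le_of_forall_le hτ hτ1 (valuation_mulVec_le (fun i j => (hγ i j).2)
      fun i => (valuation_le_latticeNorm hτ hτ1 _ i).trans hγx)).trans_eq ?_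
    simp only [pow_succ, pow_zero, one_mul]
    ac_rfl
  have hy : latticeNorm τ y ≤ B * B * τ⁻¹ ^ 4 := by
    have h : latticeNorm τ y ≤ τ⁻¹ * latticeNorm τ x := (le_inv_mul_iff₀ hτ).2 hle
    refine h.trans ((mul_le_mul_right hx _).trans_eq ?_)
    simp only [pow_succ, pow_zero, one_mul]
    ac_rfl
  refine mem_boundedSet_of_col hv (one_le_mul hBB (one_le_pow₀ hτ'))
    (fun i => (valuation_le_latticeNorm hτ hτ1 x i).trans (hx.trans ?_))
    (fun i => (valuation_le_latticeNorm hτ hτ1 y i).trans hy)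
  exact mul_le_mul_right (pow_le_pow_right₀ hτ' (by norm_num)) _

end Halves

/-! ### Double cosets -/

section DoubleCosets

open ValuativeRel

variable {F E : Type*} [Field F] [Field E] [Algebra F E] {conj : E ≃ₐ[F] E}

lemma alphaU21_zpow_val (ϖ : Fˣ) (n : ℤ) : (alphaU21 conj ϖ ^ n).1.1 =
    Matrix.diagonal ![algebraMap F E ϖ ^ (-n), 1, algebraMap F E ϖ ^ n] := by
  have hϖ : algebraMap F E ϖ ≠ 0 := by simp
  have hα : (alphaU21 conj ϖ).1.1 =
      Matrix.diagonal ![(algebraMap F E ϖ)⁻¹, 1, algebraMap F E ϖ] := by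
    simp [alphaU21]
  have hα' : (alphaU21 conj ϖ)⁻¹.1.1 =
      Matrix.diagonal ![algebraMap F E ϖ, 1, (algebraMap F E ϖ)⁻¹] := by
    change Matrix.diagonal ![algebraMap F E ϖ, 1, algebraMap F E ↑ϖ⁻¹] = _
    simp
  induction n with
  | zero =>
    refine Matrix.diagonal_one.symm.trans ?_
    congr 1
    ext i
    fin_cases i <;> simp
  | succ n ih =>
    rw [zpow_add_one, Subgroup.coe_mul, Units.val_mul, ih, hα, Matrix.diagonal_mul_diagonal]
    congr 1
    ext i
    fin_cases i <;> simp [zpow_add₀ hϖ, mul_comm]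
  | pred n ih =>
    rw [zpow_sub_one, Subgroup.coe_mul, Units.val_mul, ih, hα', Matrix.diagonal_mul_diagonal]
    congr 1
    ext i
    fin_cases i <;> simp [zpow_add₀ hϖ, zpow_sub₀ hϖ, div_eq_mul_inv, mul_comm]

variable [ValuativeRel E]

/-- The diagonal entries of the elements of the Iwahori subgroup are units, as the off-diagonal
terms of a diagonal entry of `g * g⁻¹ = 1` lie in the maximal ideal. -/
lemma valuation_diag_eq_one {m : Matrix (Fin 3) (Fin 3) ℤ} {h0 : ∀ i, m i i = 0}
    {hm : ∀ i j l, m i j ≤ m i l + m l j} (hsum : ∀ i j, i ≠ j → 1 ≤ m i j + m j i) {ϖ : E}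
    (hϖ : IsUniformizer ϖ) {g : U21 conj} (hg : g ∈ patternSubgroup conj m h0 hm) (i : Fin 3) :
    valuation E (g.1.1 i i) = 1 := by
  have hle : ∀ j l, valuation E (g.1.1 j l) ≤ valuation E ϖ ^ m j l := fun j l => (hg j l).1 ϖ hϖ
  have hle' : ∀ j l, valuation E (g⁻¹.1.1 j l) ≤ valuation E ϖ ^ m j l := fun j l =>
    (hg j l).2 ϖ hϖ
  refine le_antisymm (by simpa [h0] using hle i i) ?_
  by_contra! hlt
  have h1 : (g * g⁻¹).1.1 i i = 1 := by
    rw [mul_inv_cancel]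
    exact Matrix.one_apply_eq i
  have h2 : valuation E (∑ l, g.1.1 i l * g⁻¹.1.1 l i) < 1 := by
    refine (valuation E).map_sum_lt one_ne_zero fun l _ => ?_
    rw [map_mul]
    by_cases hl : i = l
    · subst hl
      exact (mul_le_of_le_one_right' (by simpa [h0] using hle' i i)).trans_lt hlt
    · refine (mul_le_mul' (hle i l) (hle' l i)).trans_lt ?_
      rw [← zpow_add₀ hϖ.valuation_pos.ne']
      refine (zpow_le_zpow_right_of_le_one₀ hϖ.valuation_pos hϖ.valuation_lt_one.le
        (hsum i l hl)).trans_lt ?_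
      simpa using hϖ.valuation_lt_one
  change (∑ l, g.1.1 i l * g⁻¹.1.1 l i) = 1 at h1
  rw [h1, map_one] at h2
  exact lt_irrefl _ h2

variable {e : Fin 2}

/-- The maximal compact subgroup preserves the norm of its lattice. -/
lemma latticeNorm_maxCompact_mul {ϖ : E} (hϖ : IsUniformizer ϖ) (κ : maxCompact conj e)
    (g : U21 conj) (j : Fin 3) :
    latticeNorm (valuation E ϖ ^ (e : ℕ)) (fun i => ((κ : U21 conj) * g).1.1 i j) =
      latticeNorm (valuation E ϖ ^ (e : ℕ)) (fun i => g.1.1 i j) := by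
  have hq := hϖ.valuation_pos
  have key : ∀ (κ : maxCompact conj e) (g : U21 conj),
      latticeNorm (valuation E ϖ ^ (e : ℕ)) (fun i => ((κ : U21 conj) * g).1.1 i j) ≤
        latticeNorm (valuation E ϖ ^ (e : ℕ)) (fun i => g.1.1 i j) := by
    intro κ g
    refine latticeNorm_mulVec_le (A := κ.1.1.1) (pow_pos hq _) (fun i l => ?_)
      (fun i => g.1.1 i j)
    have hw : ∀ i : Fin 3, (![1, 1, valuation E ϖ ^ (e : ℕ)] : Fin 3 → ValueGroupWithZero E) i =
        valuation E ϖ ^ (![0, 0, ((e : ℕ) : ℤ)] i) := by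
      intro i
      fin_cases i <;> simp
    rw [hw, hw]
    refine (mul_le_mul_left ((κ.2 i l).1 ϖ hϖ) _).trans ?_
    rw [← zpow_add₀ hq.ne']
    refine zpow_le_zpow_right_of_le_one₀ hq hϖ.valuation_lt_one.le ?_
    clear * - e i l
    revert e i l
    decide
  refine le_antisymm (key κ g) ?_
  simpa using key κ⁻¹ (κ * g)

lemma mul_mem_plusHalf_iff {ϖ : E} (hϖ : IsUniformizer ϖ) (κ : maxCompact conj e) (g : U21 conj) :
    (κ : U21 conj) * g ∈ plusHalf conj (valuation E ϖ ^ (e : ℕ)) ↔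
      g ∈ plusHalf conj (valuation E ϖ ^ (e : ℕ)) := by
  simp only [plusHalf, Set.mem_ofPred_eq, latticeNorm_maxCompact_mul hϖ]

variable {ϖ : Fˣ}

lemma valuation_alphaU21_zpow_mul (n : ℤ) (g : U21 conj) (j : Fin 3) :
    valuation E ((alphaU21 conj ϖ ^ n * g).1.1 0 j) =
        valuation E (algebraMap F E ϖ) ^ (-n) * valuation E (g.1.1 0 j) ∧
      valuation E ((alphaU21 conj ϖ ^ n * g).1.1 1 j) = valuation E (g.1.1 1 j) ∧
      valuation E ((alphaU21 conj ϖ ^ n * g).1.1 2 j) =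
        valuation E (algebraMap F E ϖ) ^ n * valuation E (g.1.1 2 j) := by
  simp only [Subgroup.coe_mul, Units.val_mul, alphaU21_zpow_val, Matrix.diagonal_mul]
  simp [-zpow_neg]

lemma valuation_iwahori_le (hϖ : IsUniformizer (algebraMap F E ϖ)) {g : U21 conj}
    (hg : g ∈ iwahori conj e) (i j : Fin 3) (n : ℤ)
    (hn : n ≤ (![!![0, 0, 0; 1, 0, 0; 1, 1, 0], !![0, 0, -1; 1, 0, 0; 2, 1, 0]] e :
      Matrix (Fin 3) (Fin 3) ℤ) i j) :
    valuation E (g.1.1 i j) ≤ valuation E (algebraMap F E ϖ) ^ n :=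
  ((hg i j).1 _ hϖ).trans
    (zpow_le_zpow_right_of_le_one₀ hϖ.valuation_pos hϖ.valuation_lt_one.le hn)

lemma valuation_iwahori_diag (hϖ : IsUniformizer (algebraMap F E ϖ)) {g : U21 conj}
    (hg : g ∈ iwahori conj e) (i : Fin 3) : valuation E (g.1.1 i i) = 1 :=
  valuation_diag_eq_one (by clear * - e; revert e; decide) hϖ hg i

lemma mem_plusHalf_of_mem_doubleCoset (hϖ : IsUniformizer (algebraMap F E ϖ)) (n : ℕ)
    {g : U21 conj}
    (hg : g ∈ DoubleCoset.doubleCoset (alphaU21 conj ϖ ^ n) (maxCompact conj e : Set (U21 conj))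
      (iwahori conj e)) :
    g ∈ plusHalf conj (valuation E (algebraMap F E ϖ) ^ (e : ℕ)) := by
  obtain ⟨κ, hκ, i, hi, rfl⟩ := DoubleCoset.mem_doubleCoset.1 hg
  rw [mul_assoc]
  refine (mul_mem_plusHalf_iff hϖ ⟨κ, hκ⟩ _).2 ?_
  have hq := hϖ.valuation_pos
  have hmono : ∀ {a b : ℤ}, a ≤ b → valuation E (algebraMap F E ϖ) ^ b ≤
      valuation E (algebraMap F E ϖ) ^ a := fun h =>
    zpow_le_zpow_right_of_le_one₀ hq hϖ.valuation_lt_one.le h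
  rw [← zpow_natCast (alphaU21 conj ϖ), plusHalf, Set.mem_ofPred_eq,
    ← zpow_natCast (valuation E _)]
  set q := valuation E (algebraMap F E ϖ)
  have hτ : 0 < q ^ ((e : ℕ) : ℤ) := zpow_pos hq _
  obtain ⟨a0, -, -⟩ := valuation_alphaU21_zpow_mul (ϖ := ϖ) n i 0
  obtain ⟨b0, b1, b2⟩ := valuation_alphaU21_zpow_mul (ϖ := ϖ) n i 2
  have h1 : q ^ (-(n : ℤ)) ≤
      latticeNorm (q ^ ((e : ℕ) : ℤ)) fun l => (alphaU21 conj ϖ ^ (n : ℤ) * i).1.1 l 0 := by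
    refine le_trans ?_ ((latticeNorm_le_iff hτ).1 le_rfl).1
    rw [a0, valuation_iwahori_diag hϖ hi, mul_one]
  refine le_trans ?_ h1
  have h2 : latticeNorm (q ^ ((e : ℕ) : ℤ)) (fun l => (alphaU21 conj ϖ ^ (n : ℤ) * i).1.1 l 2) ≤
      q ^ (-(n : ℤ) - (e : ℕ)) := by
    refine (latticeNorm_le_iff hτ).2 ⟨?_, ?_, ?_⟩
    · rw [b0, sub_eq_add_neg, zpow_add₀ hq.ne']
      exact mul_le_mul_right (valuation_iwahori_le hϖ hi 0 2 _ (by clear * - e; revert e; decide)) _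
    · rw [b1]
      exact (valuation_iwahori_le hϖ hi 1 2 0 (by clear * - e; revert e; decide)).trans
        (hmono (by omega))
    · rw [b2, valuation_iwahori_diag hϖ hi, mul_one, ← zpow_add₀ hq.ne']
      exact hmono (by omega)
  refine (mul_le_mul_right h2 _).trans_eq ?_
  rw [← zpow_add₀ hq.ne']
  congr 1
  ring

lemma notMem_plusHalf_of_mem_doubleCoset (hϖ : IsUniformizer (algebraMap F E ϖ)) (n : ℕ)
    {g : U21 conj}
    (hg : g ∈ DoubleCoset.doubleCoset (alphaU21 conj ϖ ^ (-((n : ℤ) + 1)))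
      (maxCompact conj e : Set (U21 conj)) (iwahori conj e)) :
    g ∉ plusHalf conj (valuation E (algebraMap F E ϖ) ^ (e : ℕ)) := by
  obtain ⟨κ, hκ, i, hi, rfl⟩ := DoubleCoset.mem_doubleCoset.1 hg
  rw [mul_assoc]
  refine mt (mul_mem_plusHalf_iff hϖ ⟨κ, hκ⟩ _).1 ?_
  have hq := hϖ.valuation_pos
  have hmono : ∀ {a b : ℤ}, a ≤ b → valuation E (algebraMap F E ϖ) ^ b ≤
      valuation E (algebraMap F E ϖ) ^ a := fun h =>
    zpow_le_zpow_right_of_le_one₀ hq hϖ.valuation_lt_one.le h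
  rw [plusHalf, Set.mem_ofPred_eq, ← zpow_natCast (valuation E _), not_le]
  set q := valuation E (algebraMap F E ϖ)
  have hτ : 0 < q ^ ((e : ℕ) : ℤ) := zpow_pos hq _
  obtain ⟨z, hz, hz1⟩ : ∃ z : ℤ, z = -((n : ℤ) + 1) ∧ z ≤ -1 := ⟨_, rfl, by omega⟩
  rw [← hz]
  obtain ⟨-, -, b2⟩ := valuation_alphaU21_zpow_mul (ϖ := ϖ) z i 2
  obtain ⟨a0, a1, a2⟩ := valuation_alphaU21_zpow_mul (ϖ := ϖ) z i 0
  have h1 : q ^ z ≤ q ^ ((e : ℕ) : ℤ) *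
      latticeNorm (q ^ ((e : ℕ) : ℤ)) fun l => (alphaU21 conj ϖ ^ z * i).1.1 l 2 := by
    rw [mul_comm]
    refine le_trans ?_ ((latticeNorm_le_iff hτ).1 le_rfl).2.2
    rw [b2, valuation_iwahori_diag hϖ hi, mul_one]
  refine lt_of_lt_of_le (lt_of_le_of_lt ?_
    (zpow_lt_zpow_right_of_lt_one₀ hq hϖ.valuation_lt_one (lt_add_one z))) h1
  refine (latticeNorm_le_iff hτ).2 ⟨?_, ?_, ?_⟩
  · rw [a0, valuation_iwahori_diag hϖ hi, mul_one]
    exact hmono (by omega)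
  · rw [a1]
    exact (valuation_iwahori_le hϖ hi 1 0 1 (by clear * - e; revert e; decide)).trans
        (hmono (by omega))
  · rw [a2, zpow_add₀ hq.ne', mul_assoc]
    refine mul_le_mul_right ?_ _
    rw [← zpow_add₀ hq.ne']
    exact valuation_iwahori_le hϖ hi 2 0 _ (by clear * - e; revert e; decide)

end DoubleCosets

/-! ### Separation by the two halves -/

section Separation

open ValuativeRel

variable {F E : Type*} [Field F] [Field E] [Algebra F E] [ValuativeRel E] [TopologicalSpace E]
  [IsNonarchimedeanLocalField E] {conj : E ≃ₐ[F] E} {e : Fin 2} {ϖ : E}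

lemma isOpen_maxCompact (hϖ : IsUniformizer ϖ) :
    IsOpen (maxCompact conj e : Set (U21 conj)) := by
  have hball : ∀ n : ℤ, IsOpen (primePow E n) := by
    intro n
    have : primePow E n = {x | valuation E x ≤ valuation E ϖ ^ n} :=
      Set.ext fun x => ⟨fun h => h ϖ hϖ, fun h ϖ' hϖ' => hϖ'.valuation_eq hϖ ▸ h⟩
    rw [this]
    exact isOpen_valuation_le (zpow_pos hϖ.valuation_pos n).ne'
  have h : ∀ i j, IsOpen {g : U21 conj | g.1.1 i j ∈ primePow E ((![!![0, 0, 0; 0, 0, 0; 0, 0, 0],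
      !![0, 0, -1; 1, 0, 0; 1, 1, 0]] e : Matrix (Fin 3) (Fin 3) ℤ) i j) ∧
      g⁻¹.1.1 i j ∈ primePow E ((![!![0, 0, 0; 0, 0, 0; 0, 0, 0],
      !![0, 0, -1; 1, 0, 0; 1, 1, 0]] e : Matrix (Fin 3) (Fin 3) ℤ) i j)} := fun i j =>
    ((hball _).preimage (continuous_entry i j)).inter
      ((hball _).preimage (continuous_inv_entry i j))
  have h' := isOpen_iInter_of_finite fun i => isOpen_iInter_of_finite (h i)
  simp only [← Set.ofPred_forall] at h'
  exact h'

/-- A set which is stable under left multiplication by `K` is open, as `K` is. -/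
lemma isOpen_of_maxCompact_mul_mem (hϖ : IsUniformizer ϖ) {A : Set (U21 conj)}
    (hA : ∀ (κ : maxCompact conj e) (g : U21 conj), g ∈ A → (κ : U21 conj) * g ∈ A) :
    IsOpen A := by
  rw [isOpen_iff_mem_nhds]
  intro g hg
  have h : (fun x => x * g⁻¹) ⁻¹' (maxCompact conj e : Set (U21 conj)) ∈ nhds g :=
    ((isOpen_maxCompact hϖ).preimage (continuous_mul_const g⁻¹)).mem_nhds (by simp)
  refine Filter.mem_of_superset h fun x hx => ?_
  simpa using hA ⟨x * g⁻¹, hx⟩ g hg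

lemma isClopen_plusHalf (hϖ : IsUniformizer ϖ) :
    IsClopen (plusHalf conj (valuation E ϖ ^ (e : ℕ))) := by
  constructor
  · rw [← isOpen_compl_iff]
    exact isOpen_of_maxCompact_mul_mem (e := e) hϖ fun κ g hg =>
      mt (mul_mem_plusHalf_iff hϖ κ g).1 hg
  · exact isOpen_of_maxCompact_mul_mem (e := e) hϖ fun κ g hg =>
      (mul_mem_plusHalf_iff hϖ κ g).2 hg

/-- The translates `C * g⁻¹` of a compact set `C` lie in one of the two halves, for all `g` outside
some compact set. -/
lemma exists_isCompact_separating (hcc : ∀ x, conj (conj x) = x)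
    (hv : ∀ x, valuation E (conj x) = valuation E x) {τ : ValueGroupWithZero E} (hτ : 0 < τ)
    (hτ1 : τ ≤ 1) {C : Set (U21 conj)} (hC : IsCompact C) :
    ∃ B : Set (U21 conj), IsCompact B ∧ ∀ g ∉ B,
      (∀ x, x * g ∈ C → x ∈ plusHalf conj τ) ∨ (∀ x, x * g ∈ C → x ∉ plusHalf conj τ) := by
  obtain ⟨b, hb, hCb⟩ := exists_subset_boundedSet hC
  refine ⟨_, isCompact_boundedSet hv (b * b * (b * b) * τ⁻¹ ^ 4 * b), fun g hg => ?_⟩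
  by_contra! h
  obtain ⟨⟨x, hxC, hx⟩, ⟨y, hyC, hy⟩⟩ := h
  refine hg ?_
  have hγ : x * y⁻¹ ∈ boundedSet conj (b * b) := by
    have := mul_mem_boundedSet (hCb hxC) (inv_mem_boundedSet (hCb hyC))
    rwa [mul_inv_rev, ← mul_assoc, mul_inv_cancel_right] at this
  have hyb := mem_boundedSet_of_mul_notMem_plusHalf hcc hv hτ hτ1 (one_le_mul hb hb) hγ hy
    (by simpa using hx)
  have := mul_mem_boundedSet (inv_mem_boundedSet hyb) (hCb hyC)
  rwa [inv_mul_cancel_left] at this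

end Separation

/-! ### The intersection of the two images -/

theorem proposition3p3
    {p : ℕ} [Fact p.Prime] (hp : p ≠ 2)
    {F : Type*} [Field F] [ValuativeRel F] [TopologicalSpace F] [IsNonarchimedeanLocalField F]
    [CharP 𝓀[F] p]
    {E : Type*} [Field E] [ValuativeRel E] [TopologicalSpace E] [IsNonarchimedeanLocalField E]
    [Algebra F E] [ValuativeExtension F E]
    (hdeg : Module.finrank F E = 2) (hunr : IsUnramifiedExtension F E)
    (conj : E ≃ₐ[F] E) (hconj : conj ≠ AlgEquiv.refl)
    (ϖ : Fˣ) (hϖ : IsUniformizer (algebraMap F E ϖ))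
    (e : Fin 2)
    {W : Type*} [AddCommGroup W] [Module (AlgebraicClosure (ZMod p)) W]
    (σ : Representation (AlgebraicClosure (ZMod p)) (maxCompact conj e) W)
    (hσ : IsSmoothRep σ) (hσirr : σ.IsIrreducible)
    {V : Type*} [AddCommGroup V] [Module (AlgebraicClosure (ZMod p)) V]
    (π : Representation (AlgebraicClosure (ZMod p)) (U21 conj) V) (hπ : IsSmoothRep π)
    (ι : (compactIndRep (maxCompact conj e) σ).IntertwiningMap π)
    (hι : Function.Surjective ι)
    (hfg : ι.ker.asSubmodule.FG) :
    FiniteDimensional (AlgebraicClosure (ZMod p))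
      ↥((Iplus conj ϖ e σ).map ι.toLinearMap ⊓ (Iminus conj ϖ e σ).map ι.toLinearMap) := by
  have hcc := conj_conj hdeg conj hconj
  have hv := valuation_conj (valuation_two_eq_one (F := F) (E := E) hp) hϖ conj hcc
  refine finiteDimensional_map_inf_map_of_ker_fg ι hfg (isClopen_plusHalf (e := e) hϖ)
    (mul_mem_plusHalf_iff hϖ)
    (fun C hC => exists_isCompact_separating hcc hv (pow_pos hϖ.valuation_pos _)
      (pow_le_one' hϖ.valuation_lt_one.le _) hC) ?_ ?_
  · -- The functions supported in the first half form a submodule containing all `R⁺_n(σ)`.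
    have hle : Iplus conj ϖ e σ ≤ compactIndSupportedOn _ σ
        (plusHalf conj (ValuativeRel.valuation E (algebraMap F E ϖ) ^ (e : ℕ))) :=
      iSup_le fun n f hf g hg => hf g fun h => hg (mem_plusHalf_of_mem_doubleCoset hϖ n h)
    exact fun f hf g hg => not_not.1 fun h => hg (hle hf g h)
  · have hle : Iminus conj ϖ e σ ≤ compactIndSupportedOn _ σ
        (plusHalf conj (ValuativeRel.valuation E (algebraMap F E ϖ) ^ (e : ℕ)))ᶜ :=
      iSup_le fun n f hf g hg => hf g fun h => hg (notMem_plusHalf_of_mem_doubleCoset hϖ n h)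
    exact fun f hf g hg h => hg (hle hf g fun h' => h' h)
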